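/- A skew brace is a set $A$ with two group structures $(A,+)$ and $(A,\circ)$ (neither assumed commutative) such that $a\circ(b+c)=a\circ b-a+a\circ c$ for all $a,b,c\in A$; it is of abelian type if $(A,+)$ is abelian. Put $\lambda_a(x)=-a+a\circ x$; this defines an action of $(A,\circ)$ on $(A,+)$ by automorphisms, and $\theta_{(a,b)}(c)=a+\lambda_b(c)-a$ defines an action of $(A,+)\rtimes_\lambda(A,\circ)$ on $(A,+)$ by automorphisms. For finite $A$, the $\theta$-graph $\Theta(A)$ is the simple graph whose vertices are the $\theta$-orbits with more than one element, two different orbits $L_1,L_2$ being adjacent if $\gcd(|L_1|,|L_2|)\neq 1$. **Theorem.** Let $A$ be a finite skew brace such that $\Theta(A)$ has exactly one vertex. Then $A$ is of abelian type, and $A$ is isomorphic, as a skew brace, to one of the following three skew braces, each with the usual addition of the group on which it is defined: 1. the skew brace on $\mathbb{Z}/4\mathbb{Z}$ with $x\circ y=x+y+2xy$; 2. the skew brace on $\mathbb{Z}/2\mathbb{Z}\times\mathbb{Z}/2\mathbb{Z}$ with $(x_1,y_1)\circ(x_2,y_2)=(x_1+x_2+y_1y_2,\;y_1+y_2)$;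 3. the skew brace on $\mathbb{Z}/2\mathbb{Z}\times\mathbb{Z}/4\mathbb{Z}$ with $$(x_1,y_1)\circ(x_2,y_2)=\Bigl(x_1+x_2+y_2\sum_{i=1}^{y_1-1}i,\;\;y_1+y_2+2y_1y_2\Bigr),$$ where in the sum $y_1$ is represented by an integer in $\{0,1,2,3\}$ (the sum is empty for $y_1\in\{0,1\}$) and the first coordinate is read modulo $2$. -/

import Mathlib

/-- A skew brace `(A, +, ∘)`: the operation `∘` is written `*` and the inverse of `a` for `∘` is
written `a⁻¹`. The additive group need not be commutative. -/
class SkewBrace (A : Type*) extends AddGroup A, Group A where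
  mul_add_skew : ∀ a b c : A, a * (b + c) = a * b - a + a * c

namespace SkewBrace

section CommonDivisorGraph

variable {G H : Type*} [Group G] [Group H]

/-- The orbit of `a` under an action `α` by automorphisms. -/
def orbit (α : G →* MulAut H) (a : H) : Set H := Set.range fun g : G => α g a

/-- The non-trivial orbits (those with more than one element) of an action `α` by automorphisms
of a finite group on a finite group. -/
def NontrivialOrbit (α : G →* MulAut H) : Type _ :=
  {L : Set H // (∃ a : H, L = orbit α a) ∧ 1 < L.ncard}

/-- The common divisor graph of an action `α` by automorphisms: the vertices are the non-trivial
orbits, and two different orbits are adjacent if their sizes are not coprime. -/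
def commonDivisorGraph (α : G →* MulAut H) : SimpleGraph (NontrivialOrbit α) where
  Adj L₁ L₂ := L₁ ≠ L₂ ∧ Nat.gcd L₁.1.ncard L₂.1.ncard ≠ 1
  symm := ⟨fun _ _ h => ⟨h.1.symm, by rw [Nat.gcd_comm]; exact h.2⟩⟩
  loopless := ⟨fun _ h => h.1 rfl⟩

end CommonDivisorGraph

section Actions

variable {A : Type*} [SkewBrace A]

theorem mul_zero_skew (a : A) : a * (0 : A) = a := by
  have h := mul_add_skew a 0 0
  rw [add_zero] at h
  have h2 : a * (0 : A) + 0 = a * 0 + (-a + a * 0) := by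
    rw [add_zero, ← add_assoc, ← sub_eq_add_neg]; exact h
  have h3 := add_left_cancel h2
  have h4 : a + 0 = a + (-a + a * 0) := by rw [← h3]
  rw [add_zero, add_neg_cancel_left] at h4
  exact h4.symm

theorem zero_eq_one_skew : (0 : A) = 1 := by
  have h := mul_zero_skew (1 : A)
  rwa [one_mul] at h

theorem lambda_add (a x y : A) : -a + a * (x + y) = (-a + a * x) + (-a + a * y) := by
  rw [mul_add_skew, sub_eq_add_neg]; simp only [add_assoc]

theorem lambda_mul (a b x : A) : -(a * b) + a * b * x = -a + a * (-b + b * x) := by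
  have h := mul_add_skew a b (-b + b * x)
  rw [add_neg_cancel_left, ← mul_assoc] at h
  rw [h, sub_eq_add_neg]
  simp only [add_assoc, neg_add_cancel_left]

theorem lambda_one (x : A) : -(1 : A) + 1 * x = x := by
  rw [← zero_eq_one_skew (A := A), neg_zero, zero_add, zero_eq_one_skew, one_mul]

/-- The automorphism `λ_a : x ↦ -a + a ∘ x` of `(A, +)`. -/
def lambdaEquiv (a : A) : A ≃+ A where
  toFun x := -a + a * x
  invFun x := -a⁻¹ + a⁻¹ * x
  left_inv x := by
    change -a⁻¹ + a⁻¹ * (-a + a * x) = x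
    rw [← lambda_mul, inv_mul_cancel, lambda_one]
  right_inv x := by
    change -a + a * (-a⁻¹ + a⁻¹ * x) = x
    rw [← lambda_mul, mul_inv_cancel, lambda_one]
  map_add' := lambda_add a

variable (A)

/-- The action `λ` of `(A, ∘)` on `(A, +)` by automorphisms. -/
def lambda : A →* MulAut (Multiplicative A) where
  toFun a := AddEquiv.toMultiplicative (lambdaEquiv a)
  map_one' := MulEquiv.ext fun x => congrArg Multiplicative.ofAdd (lambda_one x.toAdd)
  map_mul' a b := MulEquiv.ext fun x => congrArg Multiplicative.ofAdd (lambda_mul a b x.toAdd)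

/-- The action `θ` of `(A, +) ⋊_λ (A, ∘)` on `(A, +)` by automorphisms,
`θ_{(a,b)}(c) = a + λ_b(c) - a` (see `theta_apply`). -/
def theta : (Multiplicative A ⋊[lambda A] A) →* MulAut (Multiplicative A) :=
  SemidirectProduct.lift MulAut.conj (lambda A) fun g => by
    ext n x
    simp [MulAut.conj_apply, MulAut.mul_apply]

variable {A}

theorem lambda_apply (a x : A) :
    (lambda A a (Multiplicative.ofAdd x)).toAdd = -a + a * x := rfl

theorem theta_apply (a b c : A) :
    (theta A ⟨Multiplicative.ofAdd a, b⟩ (Multiplicative.ofAdd c)).toAdd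
      = a + (-b + b * c) - a := by
  rw [sub_eq_add_neg]; rfl

end Actions

/-- The `θ`-graph of a skew brace. -/
def thetaGraph (A : Type*) [SkewBrace A] : SimpleGraph (NontrivialOrbit (theta A)) :=
  commonDivisorGraph (theta A)

/-- The graph `Γ` on the vertex set `V` has exactly one vertex. -/
def HasExactlyOneVertex {V : Type*} (_Γ : SimpleGraph V) : Prop := Nat.card V = 1

/-- A skew brace is of abelian type if its additive group is abelian. -/
def IsOfAbelianType (A : Type*) [SkewBrace A] : Prop := ∀ a b : A, a + b = b + a

/-- The carrier `ℤ/4` of the first skew brace. -/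
def BraceZ4 : Type := ZMod 4

/-- The usual addition of `ℤ/4`, with `x ∘ y = x + y + 2xy`. -/
instance : SkewBrace BraceZ4 :=
  { (inferInstanceAs (AddGroup (ZMod 4)) : AddGroup BraceZ4) with
    mul := fun x y : ZMod 4 => (x + y + 2 * x * y : ZMod 4)
    one := (0 : ZMod 4)
    inv := fun x : ZMod 4 => (-x - 2 * x * x : ZMod 4)
    mul_assoc := (by decide : ∀ x y z : ZMod 4,
      (x + y + 2 * x * y) + z + 2 * (x + y + 2 * x * y) * z
        = x + (y + z + 2 * y * z) + 2 * x * (y + z + 2 * y * z))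
    one_mul := (by decide : ∀ x : ZMod 4, 0 + x + 2 * 0 * x = x)
    mul_one := (by decide : ∀ x : ZMod 4, x + 0 + 2 * x * 0 = x)
    inv_mul_cancel := (by decide : ∀ x : ZMod 4,
      (-x - 2 * x * x) + x + 2 * (-x - 2 * x * x) * x = 0)
    mul_add_skew := (by decide : ∀ x y z : ZMod 4,
      x + (y + z) + 2 * x * (y + z) = (x + y + 2 * x * y) - x + (x + z + 2 * x * z)) }

/-- The carrier `ℤ/2 × ℤ/2` of the second skew brace. -/
def BraceZ2Z2 : Type := ZMod 2 × ZMod 2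

/-- The operation `(x₁, y₁) ∘ (x₂, y₂) = (x₁ + x₂ + y₁y₂, y₁ + y₂)` on `ℤ/2 × ℤ/2`. -/
def circZ2Z2 (a b : ZMod 2 × ZMod 2) : ZMod 2 × ZMod 2 :=
  (a.1 + b.1 + a.2 * b.2, a.2 + b.2)

/-- The usual addition of `ℤ/2 × ℤ/2`, with the operation `circZ2Z2`. -/
instance : SkewBrace BraceZ2Z2 :=
  { (inferInstanceAs (AddGroup (ZMod 2 × ZMod 2)) : AddGroup BraceZ2Z2) with
    mul := circZ2Z2
    one := ((0, 0) : ZMod 2 × ZMod 2)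
    inv := fun a : ZMod 2 × ZMod 2 => ((-a.1 - a.2 * a.2, -a.2) : ZMod 2 × ZMod 2)
    mul_assoc := (by decide : ∀ a b c : ZMod 2 × ZMod 2,
      circZ2Z2 (circZ2Z2 a b) c = circZ2Z2 a (circZ2Z2 b c))
    one_mul := (by decide : ∀ a : ZMod 2 × ZMod 2, circZ2Z2 (0, 0) a = a)
    mul_one := (by decide : ∀ a : ZMod 2 × ZMod 2, circZ2Z2 a (0, 0) = a)
    inv_mul_cancel := (by decide : ∀ a : ZMod 2 × ZMod 2,
      circZ2Z2 (-a.1 - a.2 * a.2, -a.2) a = (0, 0))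
    mul_add_skew := (by decide : ∀ a b c : ZMod 2 × ZMod 2,
      circZ2Z2 a (b + c) = circZ2Z2 a b - a + circZ2Z2 a c) }

/-- The carrier `ℤ/2 × ℤ/4` of the third skew brace. -/
def BraceZ2Z4 : Type := ZMod 2 × ZMod 4

/-- The class in `ℤ/2` of `∑_{i=1}^{y-1} i`, where `y` is represented in `{0, 1, 2, 3}`
(the sum is empty for `y = 0` and `y = 1`). -/
def sumBelow (y : ZMod 4) : ZMod 2 := ((∑ i ∈ Finset.Ico 1 y.val, i : ℕ) : ZMod 2)

/-- The reduction `ℤ/4 → ℤ/2`. -/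
def redMod2 (y : ZMod 4) : ZMod 2 := ZMod.castHom (by norm_num : 2 ∣ 4) (ZMod 2) y

/-- The operation
`(x₁, y₁) ∘ (x₂, y₂) = (x₁ + x₂ + y₂ ∑_{i=1}^{y₁-1} i, y₁ + y₂ + 2y₁y₂)` on `ℤ/2 × ℤ/4`. -/
def circZ2Z4 (a b : ZMod 2 × ZMod 4) : ZMod 2 × ZMod 4 :=
  (a.1 + b.1 + redMod2 b.2 * sumBelow a.2, a.2 + b.2 + 2 * a.2 * b.2)

/-- The inverse for the operation `circZ2Z4`. -/
def invZ2Z4 (a : ZMod 2 × ZMod 4) : ZMod 2 × ZMod 4 :=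
  (-a.1 - redMod2 a.2 * sumBelow a.2, -a.2 - 2 * a.2 * a.2)

set_option maxRecDepth 100000 in
/-- The usual addition of `ℤ/2 × ℤ/4`, with the operation `circZ2Z4`. -/
instance : SkewBrace BraceZ2Z4 :=
  { (inferInstanceAs (AddGroup (ZMod 2 × ZMod 4)) : AddGroup BraceZ2Z4) with
    mul := circZ2Z4
    one := ((0, 0) : ZMod 2 × ZMod 4)
    inv := invZ2Z4
    mul_assoc := (by decide +kernel : ∀ a b c : ZMod 2 × ZMod 4,
      circZ2Z4 (circZ2Z4 a b) c = circZ2Z4 a (circZ2Z4 b c))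
    one_mul := (by decide +kernel : ∀ a : ZMod 2 × ZMod 4, circZ2Z4 (0, 0) a = a)
    mul_one := (by decide +kernel : ∀ a : ZMod 2 × ZMod 4, circZ2Z4 a (0, 0) = a)
    inv_mul_cancel := (by decide +kernel : ∀ a : ZMod 2 × ZMod 4,
      circZ2Z4 (invZ2Z4 a) a = (0, 0))
    mul_add_skew := (by decide +kernel : ∀ a b c : ZMod 2 × ZMod 4,
      circZ2Z4 a (b + c) = circZ2Z4 a b - a + circZ2Z4 a c) }

end SkewBrace

/-!
Let `F` be the subgroup of fixed points of `θ`; it is central in `(A, +)`. If there is only one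
non-trivial orbit, it is the complement of `F`, so all elements outside `F` have the same order
modulo `F`, a prime `p`. Comparing `x` with `x + c` for `c ∈ F` shows that `F` has exponent `p`.
Thus `A` is a `p`-group, the orbit size `|F| ([A : F] - 1)` is a power of `p`, and `[A : F] = 2`. In
particular `(A, +)` is abelian.

Fix `x ∉ F` and write `φ a = λ_a(x) - x`, a homomorphism from `(A, ∘)` onto `(F, +)`. With
`v = φ x` and `u = φ v` one finds `F = {0, u, v, u + v}` and `φ (k x) = k v + (k choose 2) u`, so
the multiplication is determined by `u`, `v` and `2 x ∈ F`. If `u = 0`, the cases `2 x = v` and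
`2 x = 0` give the first two braces. If `u ≠ 0`, then `φ (2 x) = u` leaves `2 x ∈ {v, u + v}`, and
replacing `x` by `v + x` if necessary one may assume `2 x = v`; this gives the third brace.
-/

namespace SkewBrace

section ActionsByAutomorphisms

variable {G H : Type*} [Group G] [Group H] {α : G →* MulAut H}

/-- The subgroup of the elements of `H` fixed by an action `α` by automorphisms. -/
def fixedPoints (α : G →* MulAut H) : Subgroup H := FixedPoints.subgroup α.range H

theorem mem_fixedPoints {x : H} : x ∈ fixedPoints α ↔ ∀ g, α g x = x :=
  ⟨fun h g => h ⟨α g, g, rfl⟩, by rintro h ⟨_, g, rfl⟩; exact h g⟩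

theorem apply_mem_fixedPoints_iff {g : G} {x : H} :
    α g x ∈ fixedPoints α ↔ x ∈ fixedPoints α := by
  refine ⟨fun h => ?_, fun h => by rwa [mem_fixedPoints.1 h g]⟩
  have hx : α g⁻¹ (α g x) = x := by simp [map_inv]
  rw [← hx]
  rwa [mem_fixedPoints.1 h g⁻¹]

theorem mem_orbit_self (α : G →* MulAut H) (x : H) : x ∈ orbit α x := ⟨1, by simp⟩

theorem nontrivial_orbit_iff {x : H} : (orbit α x).Nontrivial ↔ x ∉ fixedPoints α := by
  rw [mem_fixedPoints, not_forall]
  constructor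
  · intro h
    obtain ⟨_, ⟨g, rfl⟩, hg⟩ := h.exists_ne x
    exact ⟨g, hg⟩
  · rintro ⟨g, hg⟩
    exact ⟨_, ⟨g, rfl⟩, x, mem_orbit_self α x, hg⟩

variable [Finite H]

theorem one_lt_ncard_orbit_iff {x : H} : 1 < (orbit α x).ncard ↔ x ∉ fixedPoints α :=
  Set.one_lt_ncard_iff_nontrivial.trans nontrivial_orbit_iff

variable (hα : HasExactlyOneVertex (commonDivisorGraph α))
include hα

theorem exists_notMem_fixedPoints : ∃ x, x ∉ fixedPoints α := by
  obtain ⟨⟨_, ⟨x, rfl⟩, hx⟩⟩ := (Nat.card_eq_one_iff_unique.1 hα).2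
  exact ⟨x, one_lt_ncard_orbit_iff.1 hx⟩

theorem orbit_eq_compl_fixedPoints {x : H} (hx : x ∉ fixedPoints α) :
    orbit α x = (fixedPoints α : Set H)ᶜ := by
  refine Set.Subset.antisymm ?_ fun y hy => ?_
  · rintro _ ⟨g, rfl⟩
    exact mt apply_mem_fixedPoints_iff.1 hx
  · have : Subsingleton (NontrivialOrbit α) := (Nat.card_eq_one_iff_unique.1 hα).1
    have hxy : orbit α x = orbit α y := congrArg Subtype.val <| this.elim
      (⟨_, ⟨x, rfl⟩, one_lt_ncard_orbit_iff.2 hx⟩ : NontrivialOrbit α)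
      ⟨_, ⟨y, rfl⟩, one_lt_ncard_orbit_iff.2 hy⟩
    exact hxy ▸ mem_orbit_self α y

theorem exists_apply_eq {x y : H} (hx : x ∉ fixedPoints α) (hy : y ∉ fixedPoints α) :
    ∃ g, α g x = y :=
  (orbit_eq_compl_fixedPoints hα hx).ge hy

theorem pow_mem_fixedPoints [(fixedPoints α).Normal] {p : ℕ} (hp : p.Prime)
    (hd : p ∣ (fixedPoints α).index) (y : H) : y ^ p ∈ fixedPoints α := by
  have := Fact.mk hp
  obtain ⟨q, hq⟩ := exists_prime_orderOf_dvd_card' (G := H ⧸ fixedPoints α) p hd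
  obtain ⟨z, rfl⟩ := QuotientGroup.mk_surjective q
  have hz : z ∉ fixedPoints α := fun h => by
    rw [(QuotientGroup.eq_one_iff z).2 h, orderOf_one] at hq
    exact hp.one_lt.ne hq
  have hzp : z ^ p ∈ fixedPoints α := by
    rw [← QuotientGroup.eq_one_iff, QuotientGroup.mk_pow, ← hq, pow_orderOf_eq_one]
  by_cases hy : y ∈ fixedPoints α
  · exact pow_mem hy p
  · obtain ⟨g, rfl⟩ := exists_apply_eq hα hz hy
    rwa [← map_pow, apply_mem_fixedPoints_iff]

theorem pow_eq_one_of_mem_fixedPoints (hF : fixedPoints α ≤ Subgroup.center H) {n : ℕ}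
    (hn : ∀ y : H, y ^ n ∈ fixedPoints α) {c : H} (hc : c ∈ fixedPoints α) : c ^ n = 1 := by
  obtain ⟨x, hx⟩ := exists_notMem_fixedPoints hα
  have hxc : x * c ∉ fixedPoints α := mt (Subgroup.mul_mem_cancel_right _ hc).1 hx
  obtain ⟨g, hg⟩ := exists_apply_eq hα hx hxc
  have hcomm : Commute x c := Subgroup.mem_center_iff.1 (hF hc) x
  have h : x ^ n = x ^ n * c ^ n := by
    rw [← hcomm.mul_pow, ← hg, ← map_pow, mem_fixedPoints.1 (hn x) g]
  exact left_eq_mul.1 h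

theorem isPGroup_of_dvd_index (hF : fixedPoints α ≤ Subgroup.center H) {p : ℕ} (hp : p.Prime)
    (hd : p ∣ (fixedPoints α).index) : IsPGroup p H := by
  have : (fixedPoints α).Normal :=
    ⟨fun c hc y => by rwa [Subgroup.mem_center_iff.1 (hF hc) y, mul_inv_cancel_right]⟩
  have hpow := pow_mem_fixedPoints hα hp hd
  refine isPGroup_iff_pow_pow_eq_one.2 fun y => ⟨2, ?_⟩
  rw [pow_two, pow_mul]
  exact pow_eq_one_of_mem_fixedPoints hα hF hpow (hpow y)

theorem exists_card_mul_index_sub_one_eq {p : ℕ} [Fact p.Prime] (hG : IsPGroup p G) :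
    ∃ n, Nat.card (fixedPoints α) * ((fixedPoints α).index - 1) = p ^ n := by
  obtain ⟨x, hx⟩ := exists_notMem_fixedPoints hα
  have horbit : MulAction.orbit α.range x = (fixedPoints α : Set H)ᶜ := by
    rw [← orbit_eq_compl_fixedPoints hα hx]
    ext y
    constructor
    · rintro ⟨⟨_, g, rfl⟩, rfl⟩
      exact ⟨g, rfl⟩
    · rintro ⟨g, rfl⟩
      exact ⟨⟨_, g, rfl⟩, rfl⟩
  obtain ⟨n, hn⟩ := (hG.of_surjective _ α.rangeRestrict_surjective).card_orbit x
  refine ⟨n, ?_⟩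
  rw [← hn, horbit, Nat.card_coe_set_eq, Set.ncard_compl, Nat.mul_sub, Subgroup.card_mul_index,
    mul_one]
  rfl

theorem index_fixedPoints_eq_two {p : ℕ} [Fact p.Prime] (hG : IsPGroup p G)
    (hd : p ∣ (fixedPoints α).index) : (fixedPoints α).index = 2 := by
  obtain ⟨n, hn⟩ := exists_card_mul_index_sub_one_eq hα hG
  have hpos : 0 < (fixedPoints α).index := Nat.pos_of_ne_zero Subgroup.index_ne_zero_of_finite
  have hcoprime : ((fixedPoints α).index - 1).Coprime p :=
    ((Nat.coprime_self_sub_left hpos).2 (Nat.coprime_one_left _)).coprime_dvd_right hd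
  have := (hcoprime.pow_right n).eq_one_of_dvd (Dvd.intro_left _ hn)
  omega

end ActionsByAutomorphisms

section FixedPoints

variable {A : Type*} [SkewBrace A]

variable (A) in
/-- The additive subgroup of the elements of a skew brace fixed by the action `θ`. -/
def thetaFixed : AddSubgroup A := AddSubgroup.toSubgroup.symm (fixedPoints (theta A))

theorem mem_thetaFixed {c : A} :
    c ∈ thetaFixed A ↔ (∀ b, lambdaEquiv b c = c) ∧ ∀ a, a + c = c + a := by
  have hθ : c ∈ thetaFixed A ↔ ∀ a b, a + lambdaEquiv b c - a = c :=
    (mem_fixedPoints (α := theta A) (x := Multiplicative.ofAdd c)).trans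
      ⟨fun h a b => (theta_apply a b c).symm.trans (h ⟨a, b⟩),
        fun h g => (theta_apply _ _ c).trans (h g.1 g.2)⟩
  rw [hθ]
  constructor
  · intro h
    have hlambda : ∀ b, lambdaEquiv b c = c := fun b => by simpa using h 0 b
    exact ⟨hlambda, fun a => eq_add_of_sub_eq (by simpa only [hlambda] using h a 0)⟩
  · rintro ⟨hlambda, hcomm⟩ a b
    rw [hlambda, hcomm, add_sub_cancel_right]

theorem fixedPoints_theta_le_center :
    fixedPoints (theta A) ≤ Subgroup.center (Multiplicative A) := fun c hc =>
  Subgroup.mem_center_iff.2 (mem_thetaFixed (c := c.toAdd).1 hc).2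

theorem thetaFixed_le_center : thetaFixed A ≤ AddSubgroup.center A := fun _ hc =>
  AddSubgroup.mem_center_iff.2 (mem_thetaFixed.1 hc).2

theorem mul_eq_add_lambdaEquiv (a x : A) : a * x = a + lambdaEquiv a x :=
  (add_neg_cancel_left a (a * x)).symm

theorem lambdaEquiv_mem_thetaFixed_iff {a x : A} :
    lambdaEquiv a x ∈ thetaFixed A ↔ x ∈ thetaFixed A := by
  have h := apply_mem_fixedPoints_iff (α := theta A) (g := ⟨1, a⟩) (x := Multiplicative.ofAdd x)
  have hθ : (theta A ⟨1, a⟩ (Multiplicative.ofAdd x)).toAdd = lambdaEquiv a x :=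
    (theta_apply 0 a x).trans (by rw [zero_add, sub_zero]; rfl)
  rw [← hθ]
  exact h

theorem mul_of_mem_thetaFixed (a : A) {c : A} (hc : c ∈ thetaFixed A) : a * c = a + c := by
  rw [mul_eq_add_lambdaEquiv, (mem_thetaFixed.1 hc).1]

theorem isOfAbelianType_of_index_thetaFixed (hF : (thetaFixed A).index = 2) :
    IsOfAbelianType A := by
  have : (thetaFixed A).Normal :=
    ⟨fun c hc a => by rwa [(mem_thetaFixed.1 hc).2, add_neg_cancel_right]⟩
  have : IsAddCyclic (A ⧸ thetaFixed A) := isAddCyclic_of_prime_card (p := 2) hF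
  have := AddMonoidHom.isAddCommutative_of_isAddCyclic_of_ker_le_center
    (QuotientAddGroup.mk' (thetaFixed A))
    ((QuotientAddGroup.ker_mk' _).le.trans thetaFixed_le_center)
  exact add_comm'

/-- The additive commutative group underlying a skew brace of abelian type. -/
abbrev IsOfAbelianType.addCommGroup (hA : IsOfAbelianType A) : AddCommGroup A where
  add_comm := hA

theorem index_thetaFixed_eq_two [Finite A] (hA : HasExactlyOneVertex (thetaGraph A)) :
    (thetaFixed A).index = 2 := by
  have : Finite (Multiplicative A) := ‹Finite A›
  obtain ⟨x, hx⟩ := exists_notMem_fixedPoints (α := theta A) hA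
  have hne : (fixedPoints (theta A)).index ≠ 1 := fun h =>
    hx (Subgroup.index_eq_one.1 h ▸ Subgroup.mem_top x)
  obtain ⟨p, hp, hd⟩ := Nat.exists_prime_and_dvd hne
  have := Fact.mk hp
  obtain ⟨n, hn⟩ := (isPGroup_of_dvd_index hA fixedPoints_theta_le_center hp hd).exists_card_eq
  have hG : IsPGroup p (Multiplicative A ⋊[lambda A] A) :=
    .of_card (n := n + n) (by rw [SemidirectProduct.card, pow_add, ← hn]; rfl)
  exact (AddSubgroup.index_toSubgroup _).symm.trans (index_fixedPoints_eq_two hA hG hd)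

end FixedPoints

section StarOperation

variable {A : Type*} [SkewBrace A]

/-- The star operation `a ∗ x = λ_a(x) - x` of a skew brace; it measures how far `λ_a` is from
fixing `x`. -/
def starOp (a x : A) : A := lambdaEquiv a x - x

theorem starOp_of_mem_thetaFixed (a : A) {c : A} (hc : c ∈ thetaFixed A) : starOp a c = 0 := by
  rw [starOp, (mem_thetaFixed.1 hc).1, sub_self]

theorem zero_starOp (x : A) : starOp 0 x = 0 := by
  have hx : lambdaEquiv 0 x = x := zero_eq_one_skew (A := A) ▸ lambda_one x
  rw [starOp, hx, sub_self]

theorem starOp_nsmul (hA : IsOfAbelianType A) (a x : A) (n : ℕ) :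
    starOp a (n • x) = n • starOp a x := by
  let _ := hA.addCommGroup
  rw [starOp, starOp, map_nsmul, nsmul_sub]

theorem starOp_add (hA : IsOfAbelianType A) (a x y : A) :
    starOp a (x + y) = starOp a x + starOp a y := by
  let _ := hA.addCommGroup
  rw [starOp, starOp, starOp, map_add, add_sub_add_comm]

theorem mul_eq_add_starOp (hA : IsOfAbelianType A) (a x : A) : a * x = a + x + starOp a x := by
  rw [mul_eq_add_lambdaEquiv, add_assoc, hA x, starOp, sub_add_cancel]

variable (hF : (thetaFixed A).index = 2)
include hF

theorem starOp_mem_thetaFixed (a x : A) : starOp a x ∈ thetaFixed A := by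
  rw [starOp, sub_eq_add_neg, AddSubgroup.add_mem_iff_of_index_two hF, neg_mem_iff,
    lambdaEquiv_mem_thetaFixed_iff]

theorem starOp_mul (a b x : A) : starOp (a * b) x = starOp a x + starOp b x := by
  have hlambda : lambdaEquiv (a * b) x = lambdaEquiv a (lambdaEquiv b x) := lambda_mul a b x
  have hb : lambdaEquiv b x = starOp b x + x := (sub_add_cancel _ _).symm
  rw [starOp, hlambda, hb, map_add, (mem_thetaFixed.1 (starOp_mem_thetaFixed hF b x)).1,
    add_sub_assoc, ← starOp, isOfAbelianType_of_index_thetaFixed hF]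

theorem starOp_add_left_of_mem_thetaFixed (a x : A) {c : A} (hc : c ∈ thetaFixed A) :
    starOp (a + c) x = starOp a x + starOp c x := by
  rw [← mul_of_mem_thetaFixed a hc, starOp_mul hF]

theorem starOp_add_left (a b x : A) :
    starOp (a + b) x + starOp (starOp a b) x = starOp a x + starOp b x := by
  rw [← starOp_add_left_of_mem_thetaFixed hF _ _ (starOp_mem_thetaFixed hF a b),
    ← mul_eq_add_starOp (isOfAbelianType_of_index_thetaFixed hF), starOp_mul hF]

theorem starOp_starOp_of_mem_thetaFixed (a x : A) {c : A} (hc : c ∈ thetaFixed A) :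
    starOp (starOp c a) x = 0 := by
  have h := starOp_add_left hF c a x
  rwa [isOfAbelianType_of_index_thetaFixed hF c, starOp_add_left_of_mem_thetaFixed hF _ _ hc,
    isOfAbelianType_of_index_thetaFixed hF (starOp a x), add_eq_left] at h

theorem starOp_nsmul_left_of_mem_thetaFixed (x : A) {c : A} (hc : c ∈ thetaFixed A) (n : ℕ) :
    starOp (n • c) x = n • starOp c x := by
  induction n with
  | zero => rw [zero_nsmul, zero_nsmul, zero_starOp]
  | succ n ih => rw [succ_nsmul, succ_nsmul, starOp_add_left_of_mem_thetaFixed hF _ _ hc, ih]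

theorem nsmul_mem_thetaFixed_iff {x : A} (hx : x ∉ thetaFixed A) {n : ℕ} :
    n • x ∈ thetaFixed A ↔ Even n := by
  induction n with
  | zero => simp
  | succ n ih =>
    rw [succ_nsmul, AddSubgroup.add_mem_iff_of_index_two hF, ih, Nat.even_add_one,
      iff_false_right hx]

end StarOperation

/-- The elements fixed by `θ` form a subgroup of index two of `(A, +)` on whose complement `θ` acts
transitively. The additive group is then abelian, so that `θ` acts through `λ` and transitivity
can be expressed by the star operation. -/
structure IsTransitiveOffFixed (A : Type*) [SkewBrace A] : Prop where
  index_eq_two : (thetaFixed A).index = 2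
  exists_starOp_eq : ∀ x ∉ thetaFixed A, ∀ c ∈ thetaFixed A, ∃ a, starOp a x = c

theorem isTransitiveOffFixed {A : Type*} [SkewBrace A] [Finite A]
    (hA : HasExactlyOneVertex (thetaGraph A)) : IsTransitiveOffFixed A where
  index_eq_two := index_thetaFixed_eq_two hA
  exists_starOp_eq x hx c hc := by
    have : Finite (Multiplicative A) := ‹Finite A›
    have hcx : c + x ∉ thetaFixed A := mt (AddSubgroup.add_mem_cancel_left _ hc).1 hx
    obtain ⟨⟨a, b⟩, hab⟩ := exists_apply_eq (α := theta A) (x := Multiplicative.ofAdd x)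
      (y := Multiplicative.ofAdd (c + x)) hA hx hcx
    have hθ : a.toAdd + lambdaEquiv b x - a.toAdd = c + x := (theta_apply _ b x).symm.trans hab
    rw [isOfAbelianType_of_index_thetaFixed (index_thetaFixed_eq_two hA) a.toAdd,
      add_sub_cancel_right] at hθ
    exact ⟨b, by rw [starOp, hθ, add_sub_cancel_right]⟩

namespace IsTransitiveOffFixed

variable {A : Type*} [SkewBrace A] (h : IsTransitiveOffFixed A)
include h

theorem isOfAbelianType : IsOfAbelianType A := isOfAbelianType_of_index_thetaFixed h.index_eq_two

theorem exists_notMem : ∃ x, x ∉ thetaFixed A := by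
  by_contra! hall
  have hindex := AddSubgroup.index_eq_one.2 ((AddSubgroup.eq_top_iff' _).2 hall)
  exact absurd (h.index_eq_two.symm.trans hindex) (by decide)

theorem two_nsmul_eq_zero {c : A} (hc : c ∈ thetaFixed A) : 2 • c = 0 := by
  obtain ⟨x, hx⟩ := h.exists_notMem
  obtain ⟨a, rfl⟩ := h.exists_starOp_eq x hx c hc
  rw [← starOp_nsmul h.isOfAbelianType]
  exact starOp_of_mem_thetaFixed a (AddSubgroup.two_smul_mem_of_index_two h.index_eq_two x)

theorem addOrderOf_eq_two {c : A} (hc : c ∈ thetaFixed A) (h0 : c ≠ 0) : addOrderOf c = 2 :=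
  addOrderOf_eq_prime (h.two_nsmul_eq_zero hc) h0

theorem nsmul_eq_zero_iff {c : A} (hc : c ∈ thetaFixed A) (h0 : c ≠ 0) {n : ℕ} :
    n • c = 0 ↔ 2 ∣ n := by
  rw [← addOrderOf_dvd_iff_nsmul_eq_zero, h.addOrderOf_eq_two hc h0]

theorem mem_thetaFixed_cases {x c : A} (hx : x ∉ thetaFixed A) (hc : c ∈ thetaFixed A) :
    c = 0 ∨ c = starOp (starOp x x) x ∨ c = starOp x x ∨
      c = starOp (starOp x x) x + starOp x x := by
  have starOp_cases : ∀ c ∈ thetaFixed A,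
      ∃ d ∈ thetaFixed A, c = starOp d x ∨ c = starOp d x + starOp x x := fun c hc => by
    obtain ⟨a, rfl⟩ := h.exists_starOp_eq x hx c hc
    by_cases ha : a ∈ thetaFixed A
    · exact ⟨a, ha, Or.inl rfl⟩
    · have hd : a - x ∈ thetaFixed A := by
        rw [sub_eq_add_neg, AddSubgroup.add_mem_iff_of_index_two h.index_eq_two, neg_mem_iff]
        exact iff_of_false ha hx
      refine ⟨a - x, hd, Or.inr ?_⟩
      rw [h.isOfAbelianType, ← starOp_add_left_of_mem_thetaFixed h.index_eq_two _ _ hd,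
        h.isOfAbelianType, sub_add_cancel]
  have starOp_starOp : ∀ e ∈ thetaFixed A, starOp (starOp e x) x = 0 := fun e =>
    starOp_starOp_of_mem_thetaFixed h.index_eq_two x x
  have starOp_cases_of_mem : ∀ d ∈ thetaFixed A,
      starOp d x = 0 ∨ starOp d x = starOp (starOp x x) x := fun d hd => by
    obtain ⟨e, he, rfl | rfl⟩ := starOp_cases d hd
    · exact Or.inl (starOp_starOp e he)
    · right
      rw [starOp_add_left_of_mem_thetaFixed h.index_eq_two _ _
        (starOp_mem_thetaFixed h.index_eq_two x x), starOp_starOp e he, zero_add]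
  obtain ⟨d, hd, rfl | rfl⟩ := starOp_cases c hc <;>
    rcases starOp_cases_of_mem d hd with hd0 | hd0 <;> simp [hd0]

theorem eq_top_of_mem {x : A} (hx : x ∉ thetaFixed A) {S : AddSubgroup A} (hxS : x ∈ S)
    (hv : starOp x x ∈ S) (hu : starOp (starOp x x) x ∈ S) : S = ⊤ := by
  have hF : thetaFixed A ≤ S := fun c hc => by
    rcases h.mem_thetaFixed_cases hx hc with rfl | rfl | rfl | rfl
    exacts [zero_mem S, hu, hv, add_mem hu hv]
  refine (AddSubgroup.eq_top_iff' S).2 fun a => ?_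
  by_cases ha : a ∈ thetaFixed A
  · exact hF ha
  · have hax : a + x ∈ thetaFixed A :=
      (AddSubgroup.add_mem_iff_of_index_two h.index_eq_two).2 (iff_of_false ha hx)
    exact (S.add_mem_cancel_right hxS).1 (hF hax)

theorem starOp_ne_zero {x : A} (hx : x ∉ thetaFixed A) : starOp x x ≠ 0 := fun hv => by
  have hstar : ∀ a, starOp a x = 0 := fun a => by
    simpa only [hv, zero_starOp, add_zero, or_self] using
      h.mem_thetaFixed_cases hx (starOp_mem_thetaFixed h.index_eq_two a x)
  exact hx (mem_thetaFixed.2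
    ⟨fun a => sub_eq_zero.1 (hstar a), fun a => h.isOfAbelianType a x⟩)

/-- Since `(n x) ∘ x = n x + x + φ (n x)`, passing from `n` to `n + 1` contributes
`v - φ (φ (n x)) = v + n u`; this is where the binomial coefficient comes from. -/
theorem starOp_nsmul_self (x : A) (n : ℕ) :
    starOp (n • x) x = n • starOp x x + n.choose 2 • starOp (starOp x x) x := by
  have hF := h.index_eq_two
  have hv := starOp_mem_thetaFixed hF x x
  have hu := starOp_mem_thetaFixed hF (starOp x x) x
  induction n with
  | zero => simp only [zero_nsmul, Nat.choose_zero_succ, zero_starOp, add_zero]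
  | succ n ih =>
    have hstep := starOp_add_left hF (n • x) x x
    have hnu : starOp (starOp (n • x) x) x = n • starOp (starOp x x) x := by
      rw [ih, starOp_add_left_of_mem_thetaFixed hF _ _ (nsmul_mem hu _),
        starOp_nsmul_left_of_mem_thetaFixed hF _ hv, starOp_nsmul_left_of_mem_thetaFixed hF _ hu,
        starOp_starOp_of_mem_thetaFixed hF _ _ hv, nsmul_zero, add_zero]
    have hchar : n • starOp (starOp x x) x + n • starOp (starOp x x) x = 0 := by
      rw [← two_nsmul, h.two_nsmul_eq_zero (nsmul_mem hu n)]
    let _ := h.isOfAbelianType.addCommGroup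
    rw [← succ_nsmul, hnu, ih] at hstep
    rw [← add_left_inj (n • starOp (starOp x x) x), hstep, Nat.choose_succ_succ' n 1,
      Nat.choose_one_right, succ_nsmul (starOp x x), add_nsmul _ n]
    calc _ = n • starOp x x + starOp x x + n.choose 2 • starOp (starOp x x) x +
          (n • starOp (starOp x x) x + n • starOp (starOp x x) x) := by rw [hchar]; abel
      _ = _ := by abel

theorem add_nsmul_mul_add_nsmul (x : A) {c d : A} (hc : c ∈ thetaFixed A)
    (hcx : starOp c x = 0) (hd : d ∈ thetaFixed A) (k l : ℕ) :
    (c + k • x) * (d + l • x) = c + d + (l * k.choose 2) • starOp (starOp x x) x +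
      ((k + l) • x + (k * l) • starOp x x) := by
  have hstar : starOp (c + k • x) x = k • starOp x x + k.choose 2 • starOp (starOp x x) x := by
    rw [h.isOfAbelianType, starOp_add_left_of_mem_thetaFixed h.index_eq_two _ _ hc, hcx, add_zero,
      h.starOp_nsmul_self]
  rw [mul_eq_add_starOp h.isOfAbelianType, starOp_add h.isOfAbelianType,
    starOp_of_mem_thetaFixed _ hd, zero_add, starOp_nsmul h.isOfAbelianType, hstar]
  let _ := h.isOfAbelianType.addCommGroup
  rw [nsmul_add, add_nsmul, mul_comm k l, mul_nsmul', mul_nsmul']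
  abel

end IsTransitiveOffFixed


section HomsFromZMod

variable {A : Type*} [AddGroup A] {m n : ℕ}

/-- The additive homomorphism `ℤ/n → A` sending `1` to `a`. -/
def zmodHom (a : A) (ha : n • a = 0) : ZMod n →+ A :=
  ZMod.lift n ⟨zmultiplesHom A a, by simpa only [zmultiplesHom_apply, natCast_zsmul] using ha⟩

theorem zmodHom_intCast {a : A} (ha : n • a = 0) (k : ℤ) :
    zmodHom a ha (k : ZMod n) = k • a :=
  ZMod.lift_coe n _ k

theorem zmodHom_natCast {a : A} (ha : n • a = 0) (k : ℕ) :
    zmodHom a ha (k : ZMod n) = k • a := by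
  rw [← Int.cast_natCast, zmodHom_intCast, natCast_zsmul]

theorem mem_range_zmodHom {a : A} (ha : n • a = 0) : a ∈ (zmodHom a ha).range :=
  ⟨((1 : ℕ) : ZMod n), (zmodHom_natCast ha 1).trans (one_nsmul a)⟩

theorem zmodHom_injective [NeZero n] {a : A} (ha : n • a = 0) (hinj : ∀ k : ℕ, k • a = 0 → n ∣ k) :
    Function.Injective (zmodHom a ha) := by
  refine (injective_iff_map_eq_zero _).2 fun j hj => ?_
  obtain ⟨k, rfl⟩ := ZMod.natCast_zmod_surjective j
  rw [zmodHom_natCast] at hj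
  exact (ZMod.natCast_eq_zero_iff k n).2 (hinj k hj)

theorem addCommute_zmodHom {a b : A} (ha : m • a = 0) (hb : n • b = 0) (hab : AddCommute a b)
    (j : ZMod m) (k : ZMod n) : AddCommute (zmodHom a ha j) (zmodHom b hb k) := by
  obtain ⟨j, rfl⟩ := ZMod.intCast_surjective j
  obtain ⟨k, rfl⟩ := ZMod.intCast_surjective k
  rw [zmodHom_intCast, zmodHom_intCast]
  exact (hab.zsmul_left j).zsmul_right k

/-- The additive homomorphism `ℤ/m × ℤ/n → A` sending `(1, 0)` to `a` and `(0, 1)` to `b`. -/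
def zmodProdHom (a b : A) (ha : m • a = 0) (hb : n • b = 0) (hab : AddCommute a b) :
    ZMod m × ZMod n →+ A :=
  (zmodHom a ha).noncommCoprod (zmodHom b hb) (addCommute_zmodHom ha hb hab)

variable {a b : A} (ha : m • a = 0) (hb : n • b = 0) (hab : AddCommute a b)

theorem zmodProdHom_natCast (j k : ℕ) :
    zmodProdHom a b ha hb hab ((j : ZMod m), (k : ZMod n)) = j • a + k • b := by
  rw [← zmodHom_natCast ha j, ← zmodHom_natCast hb k]
  rfl

theorem left_mem_range_zmodProdHom : a ∈ (zmodProdHom a b ha hb hab).range :=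
  ⟨(((1 : ℕ) : ZMod m), ((0 : ℕ) : ZMod n)), by
    rw [zmodProdHom_natCast, one_nsmul, zero_nsmul, add_zero]⟩

theorem right_mem_range_zmodProdHom : b ∈ (zmodProdHom a b ha hb hab).range :=
  ⟨(((0 : ℕ) : ZMod m), ((1 : ℕ) : ZMod n)), by
    rw [zmodProdHom_natCast, one_nsmul, zero_nsmul, zero_add]⟩

theorem zmodProdHom_injective [NeZero m] [NeZero n]
    (hinj : ∀ j k : ℕ, j • a + k • b = 0 → m ∣ j ∧ n ∣ k) :
    Function.Injective (zmodProdHom a b ha hb hab) := by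
  refine (injective_iff_map_eq_zero _).2 ?_
  rintro ⟨j, k⟩ hjk
  obtain ⟨j, rfl⟩ := ZMod.natCast_zmod_surjective j
  obtain ⟨k, rfl⟩ := ZMod.natCast_zmod_surjective k
  rw [zmodProdHom_natCast] at hjk
  obtain ⟨hj, hk⟩ := hinj j k hjk
  exact Prod.ext ((ZMod.natCast_eq_zero_iff j m).2 hj) ((ZMod.natCast_eq_zero_iff k n).2 hk)

end HomsFromZMod

theorem nonempty_ringEquiv_of_addMonoidHom {A B : Type*} [AddGroup A] [Mul A] [AddGroup B] [Mul B]
    (g : B →+ A) (hinj : Function.Injective g) (hrange : g.range = ⊤)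
    (hmul : ∀ x y, g (x * y) = g x * g y) : Nonempty (A ≃+* B) :=
  ⟨RingEquiv.symm
    { Equiv.ofBijective g ⟨hinj, AddMonoidHom.range_eq_top.1 hrange⟩ with
      map_mul' := hmul
      map_add' := map_add g }⟩

theorem sumBelow_eq_choose_two : ∀ y : ZMod 4, sumBelow y = (y.val.choose 2 : ℕ) := by decide

theorem redMod2_natCast (k : ℕ) : redMod2 k = k := map_natCast _ k

namespace IsTransitiveOffFixed

variable {A : Type*} [SkewBrace A] (h : IsTransitiveOffFixed A)
include h

theorem nonempty_ringEquiv_braceZ4 {x : A} (hx : x ∉ thetaFixed A)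
    (hu : starOp (starOp x x) x = 0) (h2x : 2 • x = starOp x x) : Nonempty (A ≃+* BraceZ4) := by
  have hv := starOp_mem_thetaFixed h.index_eq_two x x
  have h4x : 4 • x = 0 := by rw [mul_nsmul x 2 2, h2x, h.two_nsmul_eq_zero hv]
  have horder : addOrderOf x = 2 ^ (1 + 1) :=
    addOrderOf_eq_prime_pow (by rw [pow_one, h2x]; exact h.starOp_ne_zero hx) h4x
  have hg : ∀ k : ℕ, zmodHom x h4x k = k • x := zmodHom_natCast h4x
  have hmul : ∀ k l : ZMod 4, zmodHom x h4x (k + l + 2 * k * l) =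
      zmodHom x h4x k * zmodHom x h4x l := fun k l => by
    obtain ⟨k, rfl⟩ := ZMod.natCast_zmod_surjective k
    obtain ⟨l, rfl⟩ := ZMod.natCast_zmod_surjective l
    have hkl : (k : ZMod 4) + l + 2 * k * l = (k + l + 2 * (k * l) : ℕ) := by push_cast; ring
    calc zmodHom x h4x (k + l + 2 * k * l) = (k + l) • x + (k * l) • starOp x x := by
          rw [hkl, hg, add_nsmul, mul_nsmul, h2x]
      _ = (0 + k • x) * (0 + l • x) := by
          rw [h.add_nsmul_mul_add_nsmul x (zero_mem _) (zero_starOp x) (zero_mem _), hu,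
            nsmul_zero, add_zero, add_zero, zero_add]
      _ = zmodHom x h4x k * zmodHom x h4x l := by rw [zero_add, zero_add, hg, hg]
  have hrange : (zmodHom x h4x).range = ⊤ := h.eq_top_of_mem hx (mem_range_zmodHom h4x)
    (h2x ▸ nsmul_mem (mem_range_zmodHom h4x) 2) (hu ▸ zero_mem _)
  exact nonempty_ringEquiv_of_addMonoidHom (B := BraceZ4) (zmodHom x h4x)
    (zmodHom_injective h4x fun k hk => horder.symm.dvd.trans (addOrderOf_dvd_of_nsmul_eq_zero hk))
    hrange hmul

theorem nonempty_ringEquiv_braceZ2Z2 {x : A} (hx : x ∉ thetaFixed A)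
    (hu : starOp (starOp x x) x = 0) (h2x : 2 • x = 0) : Nonempty (A ≃+* BraceZ2Z2) := by
  have hF := h.index_eq_two
  have hv := starOp_mem_thetaFixed hF x x
  have hv0 := h.starOp_ne_zero hx
  let g : ZMod 2 × ZMod 2 →+ A :=
    zmodProdHom (starOp x x) x (h.two_nsmul_eq_zero hv) h2x (h.isOfAbelianType _ _)
  have hg : ∀ j k : ℕ, g (j, k) = j • starOp x x + k • x := zmodProdHom_natCast _ _ _
  have hker : ∀ j k : ℕ, j • starOp x x + k • x = 0 → 2 ∣ j ∧ 2 ∣ k := fun j k hjk => by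
    have hk : 2 ∣ k := even_iff_two_dvd.1 <| (nsmul_mem_thetaFixed_iff hF hx).1 <|
      ((thetaFixed A).add_mem_cancel_left (nsmul_mem hv j)).1 (hjk ▸ zero_mem _)
    obtain ⟨m, rfl⟩ := hk
    rw [mul_nsmul, h2x, nsmul_zero, add_zero, h.nsmul_eq_zero_iff hv hv0] at hjk
    exact ⟨hjk, dvd_mul_right 2 m⟩
  have hmul : ∀ a b, g (circZ2Z2 a b) = g a * g b := by
    rintro ⟨i, k⟩ ⟨j, l⟩
    obtain ⟨i, rfl⟩ := ZMod.natCast_zmod_surjective i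
    obtain ⟨j, rfl⟩ := ZMod.natCast_zmod_surjective j
    obtain ⟨k, rfl⟩ := ZMod.natCast_zmod_surjective k
    obtain ⟨l, rfl⟩ := ZMod.natCast_zmod_surjective l
    have hcirc : circZ2Z2 (i, k) (j, l) =
        (((i + j + k * l : ℕ) : ZMod 2), ((k + l : ℕ) : ZMod 2)) := by
      simp only [circZ2Z2, Nat.cast_add, Nat.cast_mul]
    have hstar : starOp (i • starOp x x) x = 0 := by
      rw [starOp_nsmul_left_of_mem_thetaFixed hF x hv, hu, nsmul_zero]
    let _ := h.isOfAbelianType.addCommGroup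
    rw [hcirc, hg, hg, hg, h.add_nsmul_mul_add_nsmul x (nsmul_mem hv i) hstar (nsmul_mem hv j), hu,
      nsmul_zero, add_nsmul (starOp x x), add_nsmul (starOp x x)]
    abel
  have hrange : g.range = ⊤ := h.eq_top_of_mem hx (right_mem_range_zmodProdHom _ _ _)
    (left_mem_range_zmodProdHom _ _ _) (hu ▸ zero_mem _)
  exact nonempty_ringEquiv_of_addMonoidHom (B := BraceZ2Z2) g (zmodProdHom_injective _ _ _ hker)
    hrange hmul

theorem two_dvd_and_four_dvd_of_nsmul_add_nsmul_eq_zero {x : A} (hx : x ∉ thetaFixed A)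
    (hu0 : starOp (starOp x x) x ≠ 0) (h2x : 2 • x = starOp x x) {j k : ℕ}
    (hjk : j • starOp (starOp x x) x + k • x = 0) : 2 ∣ j ∧ 4 ∣ k := by
  have hF := h.index_eq_two
  have hv := starOp_mem_thetaFixed hF x x
  have hu := starOp_mem_thetaFixed hF (starOp x x) x
  obtain ⟨m, rfl⟩ : 2 ∣ k := even_iff_two_dvd.1 <| (nsmul_mem_thetaFixed_iff hF hx).1 <|
    ((thetaFixed A).add_mem_cancel_left (nsmul_mem hu j)).1 (hjk ▸ zero_mem _)
  rw [mul_nsmul, h2x] at hjk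
  have hm : m • starOp (starOp x x) x = 0 := by
    have hstar := congrArg (starOp · x) hjk
    simpa only [zero_starOp, starOp_add_left_of_mem_thetaFixed hF _ x (nsmul_mem hv m),
      starOp_nsmul_left_of_mem_thetaFixed hF x hu, starOp_nsmul_left_of_mem_thetaFixed hF x hv,
      starOp_starOp_of_mem_thetaFixed hF x x hv, nsmul_zero, zero_add] using hstar
  obtain ⟨i, rfl⟩ := (h.nsmul_eq_zero_iff hu hu0).1 hm
  rw [mul_nsmul, h.two_nsmul_eq_zero hv, nsmul_zero, add_zero, h.nsmul_eq_zero_iff hu hu0] at hjk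
  exact ⟨hjk, i, (mul_assoc 2 2 i).symm⟩

theorem nonempty_ringEquiv_braceZ2Z4 {x : A} (hx : x ∉ thetaFixed A)
    (hu0 : starOp (starOp x x) x ≠ 0) (h2x : 2 • x = starOp x x) : Nonempty (A ≃+* BraceZ2Z4) := by
  have hF := h.index_eq_two
  have hv := starOp_mem_thetaFixed hF x x
  have hu := starOp_mem_thetaFixed hF (starOp x x) x
  have h4x : 4 • x = 0 := by rw [mul_nsmul x 2 2, h2x, h.two_nsmul_eq_zero hv]
  let g : ZMod 2 × ZMod 4 →+ A :=
    zmodProdHom (starOp (starOp x x) x) x (h.two_nsmul_eq_zero hu) h4x (h.isOfAbelianType _ _)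
  have hg : ∀ j k : ℕ, g (j, k) = j • starOp (starOp x x) x + k • x := zmodProdHom_natCast _ _ _
  have hmul : ∀ a b, g (circZ2Z4 a b) = g a * g b := by
    rintro ⟨i, k⟩ ⟨j, l⟩
    obtain ⟨i, rfl⟩ := ZMod.natCast_zmod_surjective i
    obtain ⟨j, rfl⟩ := ZMod.natCast_zmod_surjective j
    obtain ⟨k, hk, rfl⟩ : ∃ n : ℕ, n < 4 ∧ (n : ZMod 4) = k :=
      ⟨k.val, k.val_lt, ZMod.natCast_zmod_val k⟩
    obtain ⟨l, rfl⟩ := ZMod.natCast_zmod_surjective l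
    have hcirc : circZ2Z4 (i, k) (j, l) =
        (((i + j + l * k.choose 2 : ℕ) : ZMod 2), ((k + l + 2 * (k * l) : ℕ) : ZMod 4)) := by
      simp only [circZ2Z4, redMod2_natCast, sumBelow_eq_choose_two, ZMod.val_natCast_of_lt hk,
        Nat.cast_add, Nat.cast_mul, Nat.cast_ofNat, mul_assoc]
    have hstar : starOp (i • starOp (starOp x x) x) x = 0 := by
      rw [starOp_nsmul_left_of_mem_thetaFixed hF x hu, starOp_starOp_of_mem_thetaFixed hF x x hv,
        nsmul_zero]
    let _ := h.isOfAbelianType.addCommGroup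
    rw [hcirc, hg, hg, hg, h.add_nsmul_mul_add_nsmul x (nsmul_mem hu i) hstar (nsmul_mem hu j),
      add_nsmul x, mul_nsmul x, h2x, add_nsmul _ (i + j), add_nsmul _ i]
  have hrange : g.range = ⊤ := h.eq_top_of_mem hx (right_mem_range_zmodProdHom _ _ _)
    (h2x ▸ nsmul_mem (right_mem_range_zmodProdHom _ _ _) 2) (left_mem_range_zmodProdHom _ _ _)
  exact nonempty_ringEquiv_of_addMonoidHom (B := BraceZ2Z4) g
    (zmodProdHom_injective _ _ _ fun j k =>
      h.two_dvd_and_four_dvd_of_nsmul_add_nsmul_eq_zero hx hu0 h2x)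
    hrange hmul

theorem exists_two_nsmul_eq_starOp {x : A} (hx : x ∉ thetaFixed A)
    (hu0 : starOp (starOp x x) x ≠ 0) :
    ∃ y ∉ thetaFixed A, starOp (starOp y y) y ≠ 0 ∧ 2 • y = starOp y y := by
  have hF := h.index_eq_two
  have hv := starOp_mem_thetaFixed hF x x
  have hstar : starOp (2 • x) x = starOp (starOp x x) x := by
    rw [h.starOp_nsmul_self, h.two_nsmul_eq_zero hv, Nat.choose_self, one_nsmul, zero_add]
  rcases h.mem_thetaFixed_cases hx (AddSubgroup.two_smul_mem_of_index_two hF x) with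
    h2x | h2x | h2x | h2x
  · rw [h2x, zero_starOp] at hstar
    exact absurd hstar.symm hu0
  · rw [h2x, starOp_starOp_of_mem_thetaFixed hF x x hv] at hstar
    exact absurd hstar.symm hu0
  · exact ⟨x, hx, hu0, h2x⟩
  · have hright : ∀ a, starOp a (starOp x x + x) = starOp a x := fun a => by
      rw [starOp_add h.isOfAbelianType, starOp_of_mem_thetaFixed a hv, zero_add]
    have hself : starOp (starOp x x + x) (starOp x x + x) = starOp (starOp x x) x + starOp x x := by
      rw [hright, h.isOfAbelianType, starOp_add_left_of_mem_thetaFixed hF _ _ hv,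
        h.isOfAbelianType]
    refine ⟨starOp x x + x, mt ((thetaFixed A).add_mem_cancel_left hv).1 hx, ?_, ?_⟩
    · rwa [hself, hright, starOp_add_left_of_mem_thetaFixed hF _ _ hv,
        starOp_starOp_of_mem_thetaFixed hF x x hv, zero_add]
    · let _ := h.isOfAbelianType.addCommGroup
      rw [hself, nsmul_add, h.two_nsmul_eq_zero hv, zero_add, h2x]

end IsTransitiveOffFixed

end SkewBrace

theorem mainTheorem6 (A : Type*) [SkewBrace A] [Finite A]
    (hA : SkewBrace.HasExactlyOneVertex (SkewBrace.thetaGraph A)) :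
    SkewBrace.IsOfAbelianType A ∧
      (Nonempty (A ≃+* SkewBrace.BraceZ4) ∨
        Nonempty (A ≃+* SkewBrace.BraceZ2Z2) ∨
        Nonempty (A ≃+* SkewBrace.BraceZ2Z4)) := by
  have h := SkewBrace.isTransitiveOffFixed hA
  refine ⟨h.isOfAbelianType, ?_⟩
  obtain ⟨x, hx⟩ := h.exists_notMem
  by_cases hu : SkewBrace.starOp (SkewBrace.starOp x x) x = 0
  · have h2x : 2 • x = 0 ∨ 2 • x = SkewBrace.starOp x x := by
      simpa only [hu, zero_add, or_self, or_self_left] using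
        h.mem_thetaFixed_cases hx (AddSubgroup.two_smul_mem_of_index_two h.index_eq_two x)
    rcases h2x with h2x | h2x
    · exact Or.inr (Or.inl (h.nonempty_ringEquiv_braceZ2Z2 hx hu h2x))
    · exact Or.inl (h.nonempty_ringEquiv_braceZ4 hx hu h2x)
  · obtain ⟨y, hy, huy, h2y⟩ := h.exists_two_nsmul_eq_starOp hx hu
    exact Or.inr (Or.inr (h.nonempty_ringEquiv_braceZ2Z4 hy huy h2y))
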